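/- Let $(R,\mathfrak m)$ be a complete Noetherian local ring with residue field $k$, let $E=E_R(k)$ be an injective hull of $k$, and write $M^\vee=\operatorname{Hom}_R(M,E)$. A closure operation $\mathrm{cl}$ on finitely generated $R$-modules assigns to each submodule $L$ of a finitely generated $R$-module $M$ a submodule $L^{\mathrm{cl}}_M$ with $L\subseteq L^{\mathrm{cl}}_M\subseteq M$, such that $(L^{\mathrm{cl}}_M)^{\mathrm{cl}}_M=L^{\mathrm{cl}}_M$, and $L^{\mathrm{cl}}_M\subseteq N^{\mathrm{cl}}_M$ whenever $L\subseteq N\subseteq M$. It is residual if $(\ker q)^{\mathrm{cl}}_M=q^{-1}(0^{\mathrm{cl}}_P)$ for every surjective $R$-linear map $q:M\to P$ of finitely generated modules. It is a Nakayama closure if, for all submodules $L\subseteq N$ of a finitely generated module $M$ with $N\subseteq (L+\mathfrak m N)^{\mathrm{cl}}_M$, one has $L^{\mathrm{cl}}_M=N^{\mathrm{cl}}_M$. An interior operation $\mathrm i$ on Artinian $R$-modules assigns to each Artinian module $A$ a submodule $\mathrm i(A)\subseteq A$, such that $\varphi(\mathrm i(A))=\mathrm i(B)$ for every isomorphism $\varphi:A\to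 B$, $\mathrm i(A)\subseteq \mathrm i(B)$ whenever $A\subseteq B$, and $\mathrm i(\mathrm i(A))=\mathrm i(A)$. It is a Nakayama interior if, for all Artinian modules $A\subseteq B$ with $\mathrm i(A:_B\mathfrak m)\subseteq A$, one has $\mathrm i(A)=\mathrm i(B)$, where $(A:_B\mathfrak m)=\{b\in B\mid \mathfrak m b\subseteq A\}$. Let $\mathrm{cl}$ be a residual closure operation on finitely generated $R$-modules. For each Artinian $R$-module $A$ (whose dual $A^\vee$ is finitely generated) put $$\mathrm i(A)=\left(\frac{A^\vee}{0^{\mathrm{cl}}_{A^\vee}}\right)^\vee,$$ regarded as a submodule of $A$ through the inclusion $\left(A^\vee/0^{\mathrm{cl}}_{A^\vee}\right)^\vee\hookrightarrow A^{\vee\vee}$ dual to the quotient map and the canonical isomorphism $A\cong A^{\vee\vee}$. Then $\mathrm i$ is an interior operation on Artinian $R$-modules, and $\mathrm{cl}$ is a Nakayama closure if and only if $\mathrm i$ is a Nakayama interior. -/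

import Mathlib

universe u

namespace ClosureInterior

open IsLocalRing

/-- `j : k → E` exhibits `E` as an injective hull of `k`: it is an essential monomorphism into an
injective module. -/
structure IsInjectiveHull {R : Type u} [CommRing R] {k E : Type u} [AddCommGroup k] [Module R k]
    [AddCommGroup E] [Module R E] (j : k →ₗ[R] E) : Prop where
  injective : Function.Injective j
  injectiveModule : Module.Injective R E
  essential : ∀ S : Submodule R E, S ⊓ LinearMap.range j = ⊥ → S = ⊥

/-- The dual `M^∨ = Hom_R(M, E)` (the Matlis dual when `E` is the injective hull of the residue
field). -/
abbrev MatlisDual (R : Type u) [CommRing R] (E : Type u) [AddCommGroup E] [Module R E]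
    (M : Type u) [AddCommGroup M] [Module R M] : Type u :=
  M →ₗ[R] E

/-- The colon submodule `(A :_B I) = {b ∈ B | I b ⊆ A}`. -/
def colonSubmodule {R : Type u} [CommRing R] {B : Type u} [AddCommGroup B] [Module R B]
    (A : Submodule R B) (I : Ideal R) : Submodule R B where
  carrier := {b | ∀ r ∈ I, r • b ∈ A}
  add_mem' ha hb r hr := by
    rw [smul_add]
    exact A.add_mem (ha r hr) (hb r hr)
  zero_mem' r _ := by simp
  smul_mem' c b hb r hr := by
    rw [smul_comm]
    exact A.smul_mem c (hb r hr)

/-- A closure operation on finitely generated `R`-modules: `cl M L` is `L^cl_M`. -/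
structure ClosureOperation (R : Type u) [CommRing R] where
  cl : ∀ (M : Type u) [AddCommGroup M] [Module R M] [Module.Finite R M],
    Submodule R M → Submodule R M
  le_cl : ∀ (M : Type u) [AddCommGroup M] [Module R M] [Module.Finite R M] (L : Submodule R M),
    L ≤ cl M L
  idempotent : ∀ (M : Type u) [AddCommGroup M] [Module R M] [Module.Finite R M]
    (L : Submodule R M), cl M (cl M L) = cl M L
  mono : ∀ (M : Type u) [AddCommGroup M] [Module R M] [Module.Finite R M] (L N : Submodule R M),
    L ≤ N → cl M L ≤ cl M N

/-- `cl` is residual: `(ker q)^cl_M = q⁻¹(0^cl_P)` for every surjection `q : M → P` of finitely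
generated modules. -/
def ClosureOperation.IsResidual {R : Type u} [CommRing R] (c : ClosureOperation R) : Prop :=
  ∀ (M P : Type u) [AddCommGroup M] [Module R M] [Module.Finite R M]
    [AddCommGroup P] [Module R P] [Module.Finite R P] (q : M →ₗ[R] P),
    Function.Surjective q → c.cl M (LinearMap.ker q) = (c.cl P ⊥).comap q

/-- `cl` is a Nakayama closure: `L ⊆ N ⊆ (L + 𝔪 N)^cl_M` implies `L^cl_M = N^cl_M`. -/
def ClosureOperation.IsNakayama {R : Type u} [CommRing R] [IsLocalRing R]
    (c : ClosureOperation R) : Prop :=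
  ∀ (M : Type u) [AddCommGroup M] [Module R M] [Module.Finite R M] (L N : Submodule R M),
    L ≤ N → N ≤ c.cl M (L ⊔ maximalIdeal R • N) → c.cl M L = c.cl M N

/-- An assignment of a submodule `i A ⊆ A` to every Artinian `R`-module `A`. -/
def ArtinianSelector (R : Type u) [CommRing R] : Type (u + 1) :=
  ∀ (A : Type u) [AddCommGroup A] [Module R A] [IsArtinian R A], Submodule R A

/-- `i` is an interior operation on Artinian modules. For a submodule `L ⊆ M`, the submodule
`i L` of `L` is regarded as a submodule of `M` by `Submodule.map L.subtype`. -/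
structure ArtinianSelector.IsInterior {R : Type u} [CommRing R] (i : ArtinianSelector R) :
    Prop where
  map_equiv : ∀ (M N : Type u) [AddCommGroup M] [Module R M] [IsArtinian R M]
    [AddCommGroup N] [Module R N] [IsArtinian R N] (φ : M ≃ₗ[R] N),
    (i M).map φ.toLinearMap = i N
  mono : ∀ (M : Type u) [AddCommGroup M] [Module R M] [IsArtinian R M] (L : Submodule R M),
    (i L).map L.subtype ≤ i M
  idempotent : ∀ (M : Type u) [AddCommGroup M] [Module R M] [IsArtinian R M],
    (i (i M)).map (i M).subtype = i M

/-- `i` is Nakayama: `i (A :_B 𝔪) ⊆ A` implies `i A = i B`, for Artinian modules `A ⊆ B`. -/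
def ArtinianSelector.IsNakayama {R : Type u} [CommRing R] [IsLocalRing R]
    (i : ArtinianSelector R) : Prop :=
  ∀ (B : Type u) [AddCommGroup B] [Module R B] [IsArtinian R B] (A : Submodule R B),
    (i (colonSubmodule A (maximalIdeal R))).map (colonSubmodule A (maximalIdeal R)).subtype ≤ A →
      (i A).map A.subtype = i B

section MatlisFinite

variable {R : Type u} [CommRing R] {E A : Type u} [AddCommGroup E] [Module R E]
  [AddCommGroup A] [Module R A]

lemma mem_ideal_smul_top_of_vanish [IsNoetherianRing R] (hE : Module.Injective R E) (I : Ideal R)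
    (f : A →ₗ[R] E) (hf : ∀ a ∈ colonSubmodule (⊥ : Submodule R A) I, f a = 0) :
    f ∈ I • (⊤ : Submodule R (A →ₗ[R] E)) := by
  classical
  obtain ⟨n, r, hr⟩ := Submodule.fg_iff_exists_fin_generating_family.mp
    (IsNoetherian.noetherian I)
  have hrI : ∀ t, r t ∈ I := fun t => hr ▸ Submodule.subset_span ⟨t, rfl⟩
  let φ : A →ₗ[R] (Fin n → A) := LinearMap.pi fun t => r t • LinearMap.id
  have hker : LinearMap.ker φ ≤ LinearMap.ker f := by
    intro a ha
    apply hf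
    intro s hs
    have ha' : ∀ t, r t • a = 0 := fun t => congrFun (LinearMap.mem_ker.mp ha) t
    have hle : I ≤ LinearMap.ker (LinearMap.toSpanSingleton R A a) := by
      rw [← hr, Submodule.span_le]
      rintro _ ⟨t, rfl⟩
      simpa using ha' t
    simpa using hle hs
  obtain ⟨g, hg⟩ := (Module.Baer.of_injective hE).extension_property
    ((LinearMap.ker φ).liftQ φ le_rfl)
    (LinearMap.ker_eq_bot.mp (Submodule.ker_liftQ_eq_bot _ _ _ le_rfl))
    ((LinearMap.ker φ).liftQ f hker)
  have hfg : f = ∑ t, r t • (g ∘ₗ LinearMap.single R (fun _ => A) t) := by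
    ext a
    have h1 : g (φ a) = f a := by
      simpa using LinearMap.congr_fun hg (Submodule.Quotient.mk a)
    rw [← h1, ← LinearMap.sum_single_apply (v := φ a)]
    simp [φ, LinearMap.sum_apply, Pi.single_smul]
  rw [hfg]
  exact Submodule.sum_mem _ fun t _ => Submodule.smul_mem_smul (hrI t) trivial

lemma vanish_of_mem_ideal_smul_top (I : Ideal R) (f : A →ₗ[R] E)
    (hf : f ∈ I • (⊤ : Submodule R (A →ₗ[R] E))) (a : A)
    (ha : a ∈ colonSubmodule (⊥ : Submodule R A) I) : f a = 0 := by
  induction hf using Submodule.smul_induction_on' with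
  | smul r hr g _ =>
    have : r • a = 0 := ha r hr
    rw [LinearMap.smul_apply, ← map_smul, this, map_zero]
  | add x _ y _ hx hy => rw [LinearMap.add_apply, hx, hy, add_zero]

lemma exists_pow_mem_colon [IsLocalRing R] [IsNoetherianRing R] [IsArtinian R A] (a : A) :
    ∃ n, a ∈ colonSubmodule (⊥ : Submodule R A) (maximalIdeal R ^ n) := by
  let c : ℕ →o (Submodule R A)ᵒᵈ :=
    ⟨fun n => OrderDual.toDual (maximalIdeal R ^ n • Submodule.span R {a}), fun m n h =>
      OrderDual.toDual_le_toDual.mpr (Submodule.smul_mono_left (Ideal.pow_le_pow_right h))⟩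
  obtain ⟨n, hn⟩ := IsArtinian.monotone_stabilizes c
  have h1 : maximalIdeal R ^ n • Submodule.span R {a} =
      maximalIdeal R ^ (n + 1) • Submodule.span R {a} := hn (n + 1) n.le_succ
  have h2 : maximalIdeal R ^ n • Submodule.span R {a} = ⊥ := by
    apply Submodule.eq_bot_of_le_smul_of_le_jacobson_bot (maximalIdeal R)
    · exact Submodule.FG.smul (IsNoetherian.noetherian _) (Submodule.fg_span_singleton a)
    · conv_lhs => rw [h1, pow_succ', Submodule.mul_smul]
    · exact (IsLocalRing.jacobson_eq_maximalIdeal ⊥ bot_ne_top).ge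
  refine ⟨n, fun r hr => ?_⟩
  rw [← h2]
  exact Submodule.smul_mem_smul hr (Submodule.mem_span_singleton_self a)

lemma finite_socle [IsLocalRing R] [IsArtinian R A] :
    Module.Finite R (colonSubmodule (⊥ : Submodule R A) (maximalIdeal R)) := by
  have hT : Module.IsTorsionBySet R (colonSubmodule (⊥ : Submodule R A) (maximalIdeal R))
      (maximalIdeal R : Set R) := by
    rintro ⟨a, ha⟩ ⟨r, hr⟩
    exact Subtype.ext (ha r hr)
  let := hT.module
  let : Field (R ⧸ maximalIdeal R) := Ideal.Quotient.field _
  have : IsSemisimpleModule R (colonSubmodule (⊥ : Submodule R A) (maximalIdeal R)) :=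
    hT.isSemisimpleModule_iff.mp
      (inferInstanceAs (IsSemisimpleModule (R ⧸ maximalIdeal R) _))
  have hA : IsArtinian R (colonSubmodule (⊥ : Submodule R A) (maximalIdeal R)) := inferInstance
  exact (IsSemisimpleModule.finite_tfae.out 2 0).mp hA

lemma isPrecomplete_pi (I : Ideal R) [IsPrecomplete I R] (n : ℕ) :
    IsPrecomplete I (Fin n → R) := by
  constructor
  intro f hf
  have hcoord : ∀ (m : ℕ) (x : Fin n → R), x ∈ (I ^ m • ⊤ : Submodule R (Fin n → R)) →
      ∀ t, x t ∈ (I ^ m • ⊤ : Submodule R R) := by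
    intro m x hx t
    have := Submodule.mem_map_of_mem (f := LinearMap.proj (R := R) (φ := fun _ : Fin n => R) t) hx
    rw [Submodule.map_smul''] at this
    exact Submodule.smul_mono le_rfl le_top this
  have hL : ∀ t, ∃ L : R, ∀ m, f m t ≡ L [SMOD (I ^ m • ⊤ : Submodule R R)] := by
    intro t
    apply IsPrecomplete.prec (inferInstance : IsPrecomplete I R)
    intro a b hab
    rw [SModEq.sub_mem]
    exact hcoord a _ (SModEq.sub_mem.mp (hf hab)) t
  choose L hL using hL
  refine ⟨L, fun m => ?_⟩
  rw [SModEq.sub_mem, pi_eq_sum_univ (f m - L)]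
  refine Submodule.sum_mem _ fun t _ => Submodule.smul_mem_smul ?_ trivial
  have := SModEq.sub_mem.mp (hL t m)
  simpa using this

/-- Over a complete Noetherian local ring the Matlis dual of an Artinian module is finitely
generated. -/
lemma finite_matlisDual [IsLocalRing R] [IsNoetherianRing R]
    [IsAdicComplete (maximalIdeal R) R] {j : ResidueField R →ₗ[R] E} (hj : IsInjectiveHull j)
    (A : Type u) [AddCommGroup A] [Module R A] [IsArtinian R A] :
    Module.Finite R (MatlisDual R E A) := by
  have hEs : IsNoetherian R (colonSubmodule (⊥ : Submodule R E) (maximalIdeal R)) := by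
    have hk : IsNoetherian R (ResidueField R) :=
      isNoetherian_of_surjective (Algebra.linearMap R (ResidueField R))
        (LinearMap.range_eq_top.mpr residue_surjective)
    have hr : IsNoetherian R (LinearMap.range j) := inferInstance
    refine isNoetherian_of_le (t := LinearMap.range j) fun x hx => ?_
    by_contra hxr
    have hx0 : Submodule.span R {x} ≠ ⊥ := by
      intro h
      rw [Submodule.span_singleton_eq_bot] at h
      exact hxr (h ▸ zero_mem _)
    obtain ⟨y, hy, hy0⟩ := Submodule.exists_mem_ne_zero_of_ne_bot (mt (hj.essential _) hx0)
    obtain ⟨hy1, hy2⟩ := hy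
    obtain ⟨r, rfl⟩ := Submodule.mem_span_singleton.mp hy1
    by_cases hrm : r ∈ maximalIdeal R
    · exact hy0 (hx r hrm)
    · have hu : IsUnit r := by simpa using hrm
      exact hxr ((Submodule.smul_mem_iff_of_isUnit _ hu).mp hy2)
  have hH : IsHausdorff (maximalIdeal R) (MatlisDual R E A) := by
    constructor
    intro f hf
    ext a
    obtain ⟨n, hn⟩ := exists_pow_mem_colon (R := R) a
    exact vanish_of_mem_ideal_smul_top _ f (SModEq.zero.mp (hf n)) a hn
  have hQ : Module.Finite R (MatlisDual R E A ⧸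
      (maximalIdeal R • ⊤ : Submodule R (MatlisDual R E A))) := by
    have := finite_socle (R := R) (A := A)
    obtain ⟨n, s, hs⟩ := Submodule.fg_iff_exists_fin_generating_family.mp
      (Module.Finite.iff_fg.mp this)
    have hsm : ∀ t, s t ∈ colonSubmodule (⊥ : Submodule R A) (maximalIdeal R) := fun t =>
      hs ▸ Submodule.subset_span ⟨t, rfl⟩
    let ev : MatlisDual R E A →ₗ[R]
        (Fin n → colonSubmodule (⊥ : Submodule R E) (maximalIdeal R)) :=
      LinearMap.pi fun t => LinearMap.codRestrict _ (LinearMap.applyₗ (s t)) fun f r hr => by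
        have h0 : r • s t = 0 := hsm t r hr
        simp [← map_smul, h0]
    have hev : LinearMap.ker ev ≤ maximalIdeal R • ⊤ := by
      intro f hf
      apply mem_ideal_smul_top_of_vanish hj.injectiveModule
      have hle : colonSubmodule (⊥ : Submodule R A) (maximalIdeal R) ≤ LinearMap.ker f := by
        rw [← hs, Submodule.span_le]
        rintro _ ⟨t, rfl⟩
        exact congrArg Subtype.val (congrFun (LinearMap.mem_ker.mp hf) t)
      exact fun a ha => hle ha
    have h1 : Module.Finite R (MatlisDual R E A ⧸ LinearMap.ker ev) :=
      Module.Finite.equiv ev.quotKerEquivRange.symm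
    exact Module.Finite.of_surjective (Submodule.factor hev) (Submodule.factor_surjective hev)
  obtain ⟨n, p, hp⟩ := Module.Finite.exists_fin' R (MatlisDual R E A ⧸
      (maximalIdeal R • ⊤ : Submodule R (MatlisDual R E A)))
  obtain ⟨q, hq⟩ := Module.projective_lifting_property
    (Submodule.mkQ (maximalIdeal R • ⊤ : Submodule R (MatlisDual R E A))) p
    (Submodule.mkQ_surjective _)
  have := isPrecomplete_pi (maximalIdeal R) n
  exact Module.Finite.of_surjective q
    (surjective_of_mkQ_comp_surjective (I := maximalIdeal R) (by rw [hq]; exact hp))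

end MatlisFinite

/-- The canonical map `A → A^∨∨`, `a ↦ (f ↦ f a)`. -/
def biduality (R : Type u) [CommRing R] (E : Type u) [AddCommGroup E] [Module R E]
    (A : Type u) [AddCommGroup A] [Module R A] :
    A →ₗ[R] MatlisDual R E (MatlisDual R E A) :=
  LinearMap.applyₗ

/-- The interior dual to `cl`: `i A = (A^∨ / 0^cl_{A^∨})^∨`, regarded as a submodule of `A`. The
quotient map `π : A^∨ → A^∨ / 0^cl_{A^∨}` induces the inclusion `π^∨` of `(A^∨ / 0^cl_{A^∨})^∨` in
`A^∨∨`, and its image is transported to `A` along the canonical map `A → A^∨∨`. -/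
noncomputable def dualInterior {R : Type u} [CommRing R] [IsLocalRing R] [IsNoetherianRing R]
    [IsAdicComplete (maximalIdeal R) R] {E : Type u} [AddCommGroup E] [Module R E]
    {j : ResidueField R →ₗ[R] E} (hj : IsInjectiveHull j) (c : ClosureOperation R) :
    ArtinianSelector R :=
  fun A _ _ _ =>
    haveI : Module.Finite R (MatlisDual R E A) := finite_matlisDual hj A
    (LinearMap.range
      (LinearMap.lcomp R E (c.cl (MatlisDual R E A) ⊥).mkQ)).comap (biduality R E A)

end ClosureInterior

/-! Matlis duality turns interiors of Artinian modules into closures of their duals. For Artinian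
`A`, annihilators and common zeros are inverse order-reversing bijections between submodules of `A`
and of `A^∨` (`commonZeros_annihilatorIn`, `annihilatorIn_commonZeros`). As `S^∨` is a quotient of
`A^∨`, residuality shows that `i S` is the common zeros of the closure of the annihilator of `S`
(`map_subtype_dualInterior`), so the interior axioms are the closure axioms read backwards.

The colon by `𝔪` is dual to multiplication by `𝔪`, so the Nakayama interior condition is the
Nakayama closure condition with `L = 0` on modules `B^∨`. This loses nothing: residuality passes
from `M` to `M/L`, which by reflexivity is the dual of an Artinian module. -/

namespace ClosureInterior

open IsLocalRing

/-! ### Annihilators and common zeros -/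

section Annihilators

variable {R : Type u} [CommRing R] {E A : Type u} [AddCommGroup E] [Module R E]
  [AddCommGroup A] [Module R A]

/-- The functionals `A → E` vanishing on `S`. -/
def annihilatorIn (E : Type u) [AddCommGroup E] [Module R E] (S : Submodule R A) :
    Submodule R (MatlisDual R E A) :=
  LinearMap.ker (LinearMap.lcomp R E S.subtype)

/-- The common zeros in `A` of a submodule of `A^∨`. -/
def commonZeros (Z : Submodule R (MatlisDual R E A)) : Submodule R A where
  carrier := {a | ∀ f ∈ Z, f a = 0}
  add_mem' ha hb f hf := by rw [map_add, ha f hf, hb f hf, add_zero]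
  zero_mem' f _ := map_zero f
  smul_mem' r a ha f hf := by rw [map_smul, ha f hf, smul_zero]

lemma mem_annihilatorIn {S : Submodule R A} {f : MatlisDual R E A} :
    f ∈ annihilatorIn E S ↔ ∀ a ∈ S, f a = 0 := by
  simp [annihilatorIn, LinearMap.ext_iff]

lemma commonZeros_anti {Y Z : Submodule R (MatlisDual R E A)} (h : Y ≤ Z) :
    commonZeros Z ≤ commonZeros Y := fun _ ha f hf => ha f (h hf)

lemma annihilatorIn_anti {S T : Submodule R A} (h : S ≤ T) :
    annihilatorIn E T ≤ annihilatorIn E S := fun _ hf =>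
  mem_annihilatorIn.mpr fun a ha => mem_annihilatorIn.mp hf a (h ha)

lemma commonZeros_smul (I : Ideal R) (Z : Submodule R (MatlisDual R E A)) :
    commonZeros (I • Z) = colonSubmodule (commonZeros Z) I := by
  ext a
  constructor
  · intro ha r hr f hf
    rw [map_smul, ← LinearMap.smul_apply]
    exact ha _ (Submodule.smul_mem_smul hr hf)
  · intro ha f hf
    induction hf using Submodule.smul_induction_on' with
    | smul r hr g hg => rw [LinearMap.smul_apply, ← map_smul]; exact ha r hr g hg
    | add x _ y _ hx hy => rw [LinearMap.add_apply, hx, hy, add_zero]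

lemma lcomp_surjective_of_injective (hE : Module.Injective R E) {B : Type u} [AddCommGroup B]
    [Module R B] (f : A →ₗ[R] B) (hf : Function.Injective f) :
    Function.Surjective (LinearMap.lcomp R E f) := fun g =>
  (Module.Baer.of_injective hE).extension_property f hf g

/-- Evaluation of functionals at the images under `p` of the standard basis vectors. -/
def evalBasis (E : Type u) [AddCommGroup E] [Module R E] {n : ℕ} (p : (Fin n → R) →ₗ[R] A) :
    MatlisDual R E A →ₗ[R] (Fin n → E) :=
  LinearMap.pi fun t => LinearMap.applyₗ (p (Pi.single t 1))

lemma evalBasis_injective {n : ℕ} (p : (Fin n → R) →ₗ[R] A) (hp : Function.Surjective p) :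
    Function.Injective (evalBasis E p) := by
  rw [injective_iff_map_eq_zero]
  intro f hf
  rw [← LinearMap.cancel_right hp]
  refine LinearMap.pi_ext' fun t => LinearMap.ext_ring ?_
  simpa [evalBasis] using congrFun hf t

end Annihilators

/-! ### The hull as a cogenerator, and its socle -/

section MatlisDuality

variable {R : Type u} [CommRing R] [IsLocalRing R] {E : Type u} [AddCommGroup E] [Module R E]
  {j : ResidueField R →ₗ[R] E}

/-- The injective hull of the residue field is a cogenerator. -/
lemma IsInjectiveHull.exists_apply_ne_zero (hj : IsInjectiveHull j) {M : Type u} [AddCommGroup M]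
    [Module R M] {x : M} (hx : x ≠ 0) : ∃ f : M →ₗ[R] E, f x ≠ 0 := by
  let s := LinearMap.toSpanSingleton R M x
  -- Since `x ≠ 0`, its annihilator lies in `𝔪`, so `R → k → E` factors through `R x`; injectivity
  -- of `E` extends it to `M`.
  let g : R →ₗ[R] E := j ∘ₗ Algebra.linearMap R (ResidueField R)
  have hker : LinearMap.ker s ≤ LinearMap.ker g := by
    intro r hr
    have hr' : r • x = 0 := hr
    have hrm : r ∈ maximalIdeal R := by
      by_contra h
      have hu : IsUnit r := by simpa using h
      exact hx (hu.smul_eq_zero.mp hr')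
    have : residue R r = 0 := (residue_eq_zero_iff r).mpr hrm
    change j (residue R r) = 0
    rw [this, map_zero]
  obtain ⟨f, hf⟩ := (Module.Baer.of_injective hj.injectiveModule).extension_property
    ((LinearMap.ker s).liftQ s le_rfl)
    (LinearMap.ker_eq_bot.mp (Submodule.ker_liftQ_eq_bot _ _ _ le_rfl))
    ((LinearMap.ker s).liftQ g hker)
  refine ⟨f, fun h0 => ?_⟩
  have h1 : f (s 1) = g 1 := LinearMap.congr_fun hf (Submodule.Quotient.mk 1)
  have h2 : g 1 = j 1 := by simp [g]
  have h3 : j 1 = j 0 := by rw [← h2, ← h1]; simpa [s] using h0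
  exact one_ne_zero (hj.injective h3)

/-- A point outside `S` is nonzero in `A/S`, so some functional on `A/S` detects it. -/
lemma IsInjectiveHull.commonZeros_annihilatorIn (hj : IsInjectiveHull j) {A : Type u}
    [AddCommGroup A] [Module R A] (S : Submodule R A) :
    commonZeros (annihilatorIn E S) = S := by
  refine le_antisymm (fun a ha => ?_) fun a ha f hf => mem_annihilatorIn.mp hf a ha
  by_contra haS
  obtain ⟨f, hf⟩ := hj.exists_apply_ne_zero
    (mt (Submodule.Quotient.mk_eq_zero S (x := a)).mp haS)
  exact hf (ha (f ∘ₗ S.mkQ) (mem_annihilatorIn.mpr fun b hb => by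
    simp [(Submodule.Quotient.mk_eq_zero S (x := b)).mpr hb]))

lemma IsInjectiveHull.biduality_injective (hj : IsInjectiveHull j) (A : Type u)
    [AddCommGroup A] [Module R A] : Function.Injective (biduality R E A) := by
  rw [injective_iff_map_eq_zero]
  intro a ha
  by_contra h
  obtain ⟨f, hf⟩ := hj.exists_apply_ne_zero h
  exact hf (LinearMap.congr_fun ha f)

/-- A module with Noetherian Matlis dual is Artinian. -/
lemma IsInjectiveHull.isArtinian_of_isNoetherian_matlisDual (hj : IsInjectiveHull j) (A : Type u)
    [AddCommGroup A] [Module R A] [IsNoetherian R (MatlisDual R E A)] : IsArtinian R A := by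
  have hanti : StrictAnti (annihilatorIn E : Submodule R A → _) :=
    (Antitone.strictAnti_of_injective fun _ _ h => annihilatorIn_anti h)
      (Function.LeftInverse.injective hj.commonZeros_annihilatorIn)
  exact hanti.wellFoundedLT

/-- By essentiality `S` meets `j(k)`, and any nonzero element of `k` generates it. -/
lemma IsInjectiveHull.range_le (hj : IsInjectiveHull j) {S : Submodule R E} (hS : S ≠ ⊥) :
    LinearMap.range j ≤ S := by
  obtain ⟨_, ⟨hyS, z, rfl⟩, hy0⟩ :=
    Submodule.exists_mem_ne_zero_of_ne_bot (mt (hj.essential _) hS)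
  have hz : z ≠ 0 := fun h => hy0 (by rw [h, map_zero])
  rintro _ ⟨w, rfl⟩
  obtain ⟨r, hr⟩ := residue_surjective (w / z)
  have : w = r • z := by
    rw [Algebra.smul_def]
    change w = residue R r * z
    rw [hr, div_mul_cancel₀ _ hz]
  rw [this, map_smul]
  exact S.smul_mem r hyS

/-- Otherwise every `𝔪^n e` is nonzero and so contains `j 1`, against Krull's intersection theorem
in `R e`. -/
lemma IsInjectiveHull.exists_pow_mem_colon [IsNoetherianRing R] (hj : IsInjectiveHull j) (e : E) :
    ∃ n, e ∈ colonSubmodule (⊥ : Submodule R E) (maximalIdeal R ^ n) := by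
  by_contra! h
  have hne : ∀ n, maximalIdeal R ^ n • Submodule.span R {e} ≠ ⊥ := by
    intro n hn
    refine h n fun r hr => ?_
    rw [← hn]
    exact Submodule.smul_mem_smul hr (Submodule.mem_span_singleton_self e)
  have hinf : ⨅ n, (maximalIdeal R ^ n • ⊤ : Submodule R (Submodule.span R {e})) = ⊥ :=
    Ideal.iInf_pow_smul_eq_bot_of_isLocalRing _ (Ideal.IsPrime.ne_top inferInstance)
  have hmem : ∀ n, j 1 ∈ maximalIdeal R ^ n • Submodule.span R {e} := fun n =>
    hj.range_le (hne n) ⟨1, rfl⟩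
  have h1 : j 1 ∈ Submodule.span R {e} := Submodule.smul_le_right (hmem 0)
  have h2 : (⟨j 1, h1⟩ : Submodule.span R {e}) ∈
      ⨅ n, (maximalIdeal R ^ n • ⊤ : Submodule R (Submodule.span R {e})) := by
    rw [Submodule.mem_iInf]
    intro n
    have := hmem n
    rw [← Submodule.map_subtype_top (Submodule.span R {e}), ← Submodule.map_smul''] at this
    obtain ⟨y, hy, hy'⟩ := this
    rwa [show (⟨j 1, h1⟩ : Submodule.span R {e}) = y from Subtype.ext hy'.symm]
  rw [hinf, Submodule.mem_bot] at h2
  exact one_ne_zero (hj.injective ((congrArg Subtype.val h2).trans (map_zero j).symm))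

lemma IsInjectiveHull.colon_bot_le_range (hj : IsInjectiveHull j) :
    colonSubmodule (⊥ : Submodule R E) (maximalIdeal R) ≤ LinearMap.range j := by
  intro x hx
  by_cases hx0 : x = 0
  · exact hx0 ▸ zero_mem _
  obtain ⟨r, hr⟩ := Submodule.mem_span_singleton.mp
    (hj.range_le (mt Submodule.span_singleton_eq_bot.mp hx0) ⟨1, rfl⟩)
  have hrm : r ∉ maximalIdeal R := fun h =>
    one_ne_zero (hj.injective ((hr.symm.trans (hx r h)).trans (map_zero j).symm))
  have hu : IsUnit r := by simpa using hrm
  exact (Submodule.smul_mem_iff_of_isUnit _ hu).mp ⟨1, hr.symm⟩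

/-! ### Matlis duality over a complete ring -/

variable [IsNoetherianRing R] [IsAdicComplete (maximalIdeal R) R]

/-- Over a complete Noetherian local ring every endomorphism of the injective hull of the residue
field is multiplication by a ring element. -/
lemma IsInjectiveHull.toSpanSingleton_id_surjective (hj : IsInjectiveHull j) :
    Function.Surjective (LinearMap.toSpanSingleton R (E →ₗ[R] E) LinearMap.id) := by
  have hH : IsHausdorff (maximalIdeal R) (E →ₗ[R] E) := by
    constructor
    intro f hf
    ext a
    obtain ⟨n, hn⟩ := hj.exists_pow_mem_colon a
    exact vanish_of_mem_ideal_smul_top _ f (SModEq.zero.mp (hf n)) a hn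
  -- By completeness of `R` and separatedness of `End E`, surjectivity can be checked modulo `𝔪`.
  -- There an endomorphism is determined by its action on the socle `j(k)`, which is a scalar.
  refine surjective_of_mkQ_comp_surjective (I := maximalIdeal R) fun y => ?_
  obtain ⟨f, rfl⟩ := Submodule.mkQ_surjective _ y
  have hsoc : f (j 1) ∈ LinearMap.range j := by
    refine hj.colon_bot_le_range fun r hr => ?_
    have h0 : r • (1 : ResidueField R) = 0 := by
      rw [Algebra.smul_def, mul_one]
      exact (residue_eq_zero_iff r).mpr hr
    rw [← map_smul, ← map_smul, h0, map_zero, map_zero]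
    exact zero_mem _
  obtain ⟨z, hz⟩ := hsoc
  obtain ⟨r, rfl⟩ := residue_surjective z
  have hr : r • j 1 = f (j 1) := by
    rw [← hz, ← map_smul, Algebra.smul_def, mul_one]
    rfl
  refine ⟨r, ?_⟩
  rw [LinearMap.comp_apply, Submodule.mkQ_apply, Submodule.mkQ_apply, Submodule.Quotient.eq]
  refine mem_ideal_smul_top_of_vanish hj.injectiveModule _ _ fun a ha => ?_
  obtain ⟨w, rfl⟩ := hj.colon_bot_le_range ha
  obtain ⟨t, rfl⟩ := residue_surjective w
  have ht : j (residue R t) = t • j 1 := by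
    rw [← map_smul, Algebra.smul_def, mul_one]
    rfl
  rw [ht, map_smul]
  simp [hr]

lemma IsInjectiveHull.isArtinian (hj : IsInjectiveHull j) : IsArtinian R E := by
  have : IsNoetherian R (MatlisDual R E E) :=
    isNoetherian_of_surjective _ (LinearMap.range_eq_top.mpr hj.toSpanSingleton_id_surjective)
  exact hj.isArtinian_of_isNoetherian_matlisDual E

section Finite

variable (M : Type u) [AddCommGroup M] [Module R M] [Module.Finite R M]

lemma IsInjectiveHull.isArtinian_matlisDual (hj : IsInjectiveHull j) :
    IsArtinian R (MatlisDual R E M) := by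
  have := hj.isArtinian
  obtain ⟨n, p, hp⟩ := Module.Finite.exists_fin' R M
  exact isArtinian_of_injective _ (evalBasis_injective (E := E) p hp)

/-- Generators of `M` embed `M^∨` in `E^n`. A functional on `M^∨` extends to `E^n`, where each
component is multiplication by a scalar; these scalars are the coefficients of the required element.
-/
lemma IsInjectiveHull.biduality_surjective_of_finite (hj : IsInjectiveHull j) :
    Function.Surjective (biduality R E M) := by
  intro φ
  obtain ⟨n, p, hp⟩ := Module.Finite.exists_fin' R M
  obtain ⟨ψ, rfl⟩ := lcomp_surjective_of_injective hj.injectiveModule _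
    (evalBasis_injective p hp) φ
  choose r hr using fun t : Fin n =>
    hj.toSpanSingleton_id_surjective (ψ ∘ₗ LinearMap.single R (fun _ => E) t)
  refine ⟨∑ t, r t • p (Pi.single t 1), LinearMap.ext fun f => ?_⟩
  have h : ∀ t (e : E), ψ (Pi.single t e) = r t • e := fun t e => by
    simpa using (LinearMap.congr_fun (hr t) e).symm
  rw [LinearMap.lcomp_apply, ← LinearMap.sum_single_apply (v := evalBasis E p f)]
  simp [biduality, h, evalBasis]

end Finite

/-- Matlis reflexivity of Artinian modules. -/
lemma IsInjectiveHull.biduality_surjective_of_isArtinian (hj : IsInjectiveHull j) (A : Type u)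
    [AddCommGroup A] [Module R A] [IsArtinian R A] :
    Function.Surjective (biduality R E A) := by
  have := finite_matlisDual hj A
  -- It suffices that only zero in `A^∨∨∨` kills the image of `A`. As `A^∨` is finite, such a
  -- functional is evaluation at some `f`, and `f` vanishes on `A`.
  rw [← LinearMap.range_eq_top, ← hj.commonZeros_annihilatorIn (LinearMap.range _), eq_top_iff]
  rintro φ - Φ hΦ
  obtain ⟨f, rfl⟩ := hj.biduality_surjective_of_finite _ Φ
  have hf : f = 0 := LinearMap.ext fun a => mem_annihilatorIn.mp hΦ _ ⟨a, rfl⟩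
  rw [hf, map_zero, LinearMap.zero_apply]

lemma IsInjectiveHull.annihilatorIn_commonZeros (hj : IsInjectiveHull j) {A : Type u}
    [AddCommGroup A] [Module R A] [IsArtinian R A] (Z : Submodule R (MatlisDual R E A)) :
    annihilatorIn E (commonZeros Z) = Z := by
  refine le_antisymm (fun f hf => ?_) fun f hf => mem_annihilatorIn.mpr fun a ha => ha f hf
  rw [← hj.commonZeros_annihilatorIn Z]
  intro φ hφ
  obtain ⟨a, rfl⟩ := hj.biduality_surjective_of_isArtinian A φ
  exact mem_annihilatorIn.mp hf a fun g hg => mem_annihilatorIn.mp hφ g hg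

end MatlisDuality

/-- Both sides are the preimage of the closure of zero in `P/S`. -/
lemma ClosureOperation.IsResidual.cl_comap {R : Type u} [CommRing R] {c : ClosureOperation R}
    (hc : c.IsResidual) {M P : Type u} [AddCommGroup M] [Module R M] [Module.Finite R M]
    [AddCommGroup P] [Module R P] [Module.Finite R P] (q : M →ₗ[R] P)
    (hq : Function.Surjective q) (S : Submodule R P) :
    c.cl M (S.comap q) = (c.cl P S).comap q := by
  have h1 := hc P (P ⧸ S) S.mkQ S.mkQ_surjective
  have h2 := hc M (P ⧸ S) (S.mkQ ∘ₗ q) (S.mkQ_surjective.comp hq)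
  rw [Submodule.ker_mkQ] at h1
  rw [LinearMap.ker_comp, Submodule.ker_mkQ] at h2
  rw [h1, h2, Submodule.comap_comp]

/-! ### Translation between interior and closure -/

section DualInterior

variable {R : Type u} [CommRing R] [IsLocalRing R] [IsNoetherianRing R]
  [IsAdicComplete (maximalIdeal R) R] {E : Type u} [AddCommGroup E] [Module R E]
  {j : ResidueField R →ₗ[R] E} (hj : IsInjectiveHull j) (c : ClosureOperation R)

lemma dualInterior_eq_commonZeros (A : Type u) [AddCommGroup A] [Module R A] [IsArtinian R A]
    [Module.Finite R (MatlisDual R E A)] :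
    dualInterior hj c A = commonZeros (c.cl (MatlisDual R E A) ⊥) := by
  ext a
  constructor
  · rintro ⟨g, hg⟩ f hf
    have h := LinearMap.congr_fun hg f
    rw [LinearMap.lcomp_apply, Submodule.mkQ_apply, (Submodule.Quotient.mk_eq_zero _).mpr hf,
      map_zero] at h
    exact h.symm
  · intro ha
    exact ⟨Submodule.liftQ _ (biduality R E A a) fun f hf => ha f hf,
      LinearMap.ext fun _ => rfl⟩

variable {c}

/-- The dual interior of a submodule `S ⊆ A` is computed by the closure of its annihilator in
`A^∨`. -/
lemma map_subtype_dualInterior (hc : c.IsResidual) {A : Type u} [AddCommGroup A] [Module R A] [IsArtinian R A]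
    [Module.Finite R (MatlisDual R E A)] (S : Submodule R A) :
    (dualInterior hj c S).map S.subtype = commonZeros (c.cl _ (annihilatorIn E S)) := by
  have := finite_matlisDual hj S
  have hr := lcomp_surjective_of_injective hj.injectiveModule S.subtype S.injective_subtype
  -- Restriction `A^∨ → S^∨` is onto with kernel the annihilator of `S`, so residuality compares the
  -- two closures.
  have hcl := hc _ _ (LinearMap.lcomp R E S.subtype) hr
  rw [dualInterior_eq_commonZeros]
  ext b
  constructor
  · rintro ⟨a, ha, rfl⟩ f hf
    have hf' : f ∈ c.cl _ (LinearMap.ker (LinearMap.lcomp R E S.subtype)) := hf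
    rw [hcl] at hf'
    exact ha _ hf'
  · intro hb
    have hbS : b ∈ S := by
      rw [← hj.commonZeros_annihilatorIn S]
      exact commonZeros_anti (c.le_cl _ _) hb
    refine ⟨⟨b, hbS⟩, fun f hf => ?_, rfl⟩
    obtain ⟨g, rfl⟩ := hr f
    have hg : g ∈ (c.cl _ ⊥).comap (LinearMap.lcomp R E S.subtype) := hf
    rw [← hcl] at hg
    exact hb g hg

lemma isInterior_dualInterior (hc : c.IsResidual) : (dualInterior hj c).IsInterior where
  map_equiv M N _ _ _ _ _ _ φ := by
    have := finite_matlisDual hj M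
    have := finite_matlisDual hj N
    have hinj : Function.Injective (LinearMap.lcomp R E φ.toLinearMap) :=
      LinearMap.lcomp_injective_of_surjective _ φ.surjective
    have hcl := hc _ _ (LinearMap.lcomp R E φ.toLinearMap)
      (lcomp_surjective_of_injective hj.injectiveModule _ φ.injective)
    rw [LinearMap.ker_eq_bot.mpr hinj] at hcl
    rw [dualInterior_eq_commonZeros, dualInterior_eq_commonZeros, hcl]
    ext b
    constructor
    · rintro ⟨a, ha, rfl⟩ f hf
      exact ha _ hf
    · intro hb
      refine ⟨φ.symm b, fun f hf => ?_, φ.apply_symm_apply b⟩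
      have hf' : f = LinearMap.lcomp R E φ.toLinearMap (f ∘ₗ φ.symm.toLinearMap) := by
        ext; simp
      exact hb (f ∘ₗ φ.symm.toLinearMap) (by rwa [hf'] at hf)
  mono M _ _ _ L := by
    have := finite_matlisDual hj M
    rw [map_subtype_dualInterior hj hc, dualInterior_eq_commonZeros]
    exact commonZeros_anti (c.mono _ _ _ bot_le)
  idempotent M _ _ _ := by
    have := finite_matlisDual hj M
    rw [map_subtype_dualInterior hj hc, dualInterior_eq_commonZeros,
      hj.annihilatorIn_commonZeros, c.idempotent]

/-- The Nakayama condition on the dual interior, expressed by the closure on `B^∨`. -/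
lemma isNakayama_dualInterior_iff (hc : c.IsResidual) : (dualInterior hj c).IsNakayama ↔
    ∀ (B : Type u) [AddCommGroup B] [Module R B] [IsArtinian R B]
      [Module.Finite R (MatlisDual R E B)] (N : Submodule R (MatlisDual R E B)),
      N ≤ c.cl _ (maximalIdeal R • N) → c.cl _ ⊥ = c.cl _ N := by
  constructor
  · intro h B _ _ _ _ N hN
    have hB := h B (commonZeros N)
    -- With `A` the common zeros of `N`, the colon becomes the common zeros of `𝔪 N`.
    rw [map_subtype_dualInterior hj hc, map_subtype_dualInterior hj hc,
      dualInterior_eq_commonZeros, ← commonZeros_smul, hj.annihilatorIn_commonZeros,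
      hj.annihilatorIn_commonZeros] at hB
    rw [← hj.annihilatorIn_commonZeros (c.cl _ ⊥), ← hB (commonZeros_anti hN),
      hj.annihilatorIn_commonZeros]
  · intro h B _ _ _ A hA
    have := finite_matlisDual hj B
    obtain ⟨N, rfl⟩ : ∃ N : Submodule R (MatlisDual R E B), commonZeros N = A :=
      ⟨_, hj.commonZeros_annihilatorIn A⟩
    rw [map_subtype_dualInterior hj hc, ← commonZeros_smul, hj.annihilatorIn_commonZeros] at hA
    rw [map_subtype_dualInterior hj hc, dualInterior_eq_commonZeros,
      hj.annihilatorIn_commonZeros, h B N]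
    have := annihilatorIn_anti (E := E) hA
    rwa [hj.annihilatorIn_commonZeros, hj.annihilatorIn_commonZeros] at this

lemma isNakayama_iff_isNakayama_dualInterior (hc : c.IsResidual) :
    c.IsNakayama ↔ (dualInterior hj c).IsNakayama := by
  rw [isNakayama_dualInterior_iff hj hc]
  constructor
  · intro h B _ _ _ _ N hN
    exact h _ ⊥ N bot_le (by rwa [bot_sup_eq])
  · intro h M _ _ _ L N hLN hN
    have := hj.isArtinian_matlisDual (M ⧸ L)
    have := finite_matlisDual hj (MatlisDual R E (M ⧸ L))
    -- `q` identifies `M/L` with the dual of the Artinian module `(M/L)^∨`, reducing to `L = 0`.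
    let q : M →ₗ[R] MatlisDual R E (MatlisDual R E (M ⧸ L)) := biduality R E (M ⧸ L) ∘ₗ L.mkQ
    have hq : Function.Surjective q :=
      (hj.biduality_surjective_of_finite (M ⧸ L)).comp L.mkQ_surjective
    have hker : LinearMap.ker q = L := by
      rw [LinearMap.ker_comp_of_ker_eq_bot _ (LinearMap.ker_eq_bot.mpr
        (hj.biduality_injective _)), Submodule.ker_mkQ]
    have hN' : (N.map q).comap q = N := by
      rw [Submodule.comap_map_eq, hker, sup_eq_left.mpr hLN]
    have hmN : (maximalIdeal R • N.map q).comap q = L ⊔ maximalIdeal R • N := by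
      rw [← Submodule.map_smul'', Submodule.comap_map_eq, hker, sup_comm]
    have hL : (⊥ : Submodule R _).comap q = L := hker
    have key := h _ (N.map q) (by
      rw [Submodule.map_le_iff_le_comap, ← hc.cl_comap q hq, hmN]
      exact hN)
    have hclL := hc.cl_comap q hq ⊥
    have hclN := hc.cl_comap q hq (N.map q)
    rw [hL] at hclL
    rw [hN'] at hclN
    rw [hclL, hclN, key]

end DualInterior

end ClosureInterior

theorem mainTheorem3 {R : Type u} [CommRing R] [IsLocalRing R] [IsNoetherianRing R]
    [IsAdicComplete (IsLocalRing.maximalIdeal R) R]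
    {E : Type u} [AddCommGroup E] [Module R E]
    {j : IsLocalRing.ResidueField R →ₗ[R] E} (hj : ClosureInterior.IsInjectiveHull j)
    (c : ClosureInterior.ClosureOperation R) (hc : c.IsResidual) :
    (ClosureInterior.dualInterior hj c).IsInterior ∧
      (c.IsNakayama ↔ (ClosureInterior.dualInterior hj c).IsNakayama) :=
  ⟨ClosureInterior.isInterior_dualInterior hj hc,
    ClosureInterior.isNakayama_iff_isNakayama_dualInterior hj hc⟩
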